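/- Let $X$ be a normal noetherian scheme (all local rings $\mathcal{O}_{X,x}$ are integrally closed domains). All sheaves are taken in the Zariski topology. Let $\mathcal{M}_X$ be the sheaf of rational functions on $X$ (locally quotients of sections of $\mathcal{O}_X$ by sections whose germs are non-zero-divisors), let $\mathcal{D}iv_X=\mathcal{M}_X^\times/\mathcal{O}_X^\times$ be the sheaf of Cartier divisors, let $\mathcal{Z}^1_X$ be the sheaf of Weil divisors (locally finite integral combinations of points of codimension one), and let $\mathcal{P}_X=\mathcal{Z}^1_X/\mathcal{D}iv_X$ be the cokernel of the homomorphism $\mathcal{D}iv_X\to\mathcal{Z}^1_X$ induced by $f\mapsto\sum_z \operatorname{ord}_z(f)\,z$. Put $\operatorname{Div}(X)=\Gamma(X,\mathcal{D}iv_X)$, $Z^1(X)=\Gamma(X,\mathcal{Z}^1_X)$, $P(X)=\Gamma(X,\mathcal{P}_X)$ and $\operatorname{Cl}(X)=Z^1(X)/\operatorname{Div}(X)$. Then the sequences $$1\to\mathcal{O}_X^\times\to\mathcal{M}_X^\times\to\mathcal{D}iv_X\to 0\qquad\text{and}\qquad 0\to\mathcal{D}iv_X\to\mathcal{Z}^1_X\to\mathcal{P}_X\to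 0$$ are exact, the canonical map $\operatorname{Cl}(X)\to P(X)$ is injective, and the composite $P(X)\to H^1_{\mathrm{Zar}}(X,\mathcal{D}iv_X)\to H^2_{\mathrm{Zar}}(X,\mathcal{O}_X^\times)$ of the connecting homomorphisms of these two sequences induces an isomorphism of groups $$P(X)/\operatorname{Cl}(X)\;\xrightarrow{\ \sim\ }\;H^2_{\mathrm{Zar}}(X,\mathcal{O}_X^\times).$$ -/

import Mathlib

universe u

noncomputable section

open CategoryTheory TopologicalSpace Opposite Limits AlgebraicGeometry

namespace AlgebraicGeometry.Scheme

/-- A scheme is normal if all its local rings are integrally closed domains. -/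
class IsNormal (X : Scheme.{u}) : Prop where
  isDomain_stalk : ∀ x : X, IsDomain (X.presheaf.stalk x)
  isIntegrallyClosed_stalk : ∀ x : X, IsIntegrallyClosed (X.presheaf.stalk x)

attribute [instance] IsNormal.isDomain_stalk IsNormal.isIntegrallyClosed_stalk

/-- Sheaves of abelian groups on the underlying topological space of `X`, that is, on the small
Zariski site of `X`. -/
abbrev ZarAb (X : Scheme.{u}) : Type (u + 1) :=
  CategoryTheory.Sheaf (Opens.grothendieckTopology X) AddCommGrpCat.{u}

/-! ### Units of a sheaf of rings -/

/-- The functor sending a commutative ring to its group of units, written additively. -/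
def unitsFunctor : CommRingCat.{u} ⥤ AddCommGrpCat.{u} :=
  forget₂ CommRingCat CommMonCat ⋙ CommMonCat.units ⋙ CommGrpCat.toAddCommGrp

instance : PreservesLimits CommGrpCat.toAddCommGrp.{u} :=
  inferInstanceAs (PreservesLimits commGroupAddCommGroupEquivalence.functor)

instance : PreservesLimits unitsFunctor.{u} := by
  unfold unitsFunctor
  infer_instance

/-- The functor sending a Zariski sheaf of commutative rings `F` to its sheaf `F^×` of units,
`U ↦ F(U)ˣ`, written additively. -/
def unitsSheafFunctor (X : Scheme.{u}) :
    CategoryTheory.Sheaf (Opens.grothendieckTopology X) CommRingCat.{u} ⥤ X.ZarAb :=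
  sheafCompose (Opens.grothendieckTopology X) unitsFunctor

/-! ### Rational functions -/

/-- The total ring of fractions of the local ring `𝒪_{X,x}`. -/
abbrev TotalFrac (X : Scheme.{u}) (x : X) : Type u := FractionRing (X.presheaf.stalk x)

/-- A family of elements `f x ∈ Frac(𝒪_{X,x})`, `x ∈ U`, is a fraction if it is of the form
`x ↦ aₓ / bₓ` for sections `a, b ∈ 𝒪_X(U)` such that all germs of `b` are non-zero-divisors. -/
def isFractionPrelocal (X : Scheme.{u}) :
    TopCat.PrelocalPredicate (X := X.carrier) (X.TotalFrac) where
  pred {U} f := ∃ a b : Γ(X, U), ∀ x : U,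
    X.presheaf.germ U x.1 x.2 b ∈ nonZeroDivisors (X.presheaf.stalk x.1) ∧
    f x * algebraMap _ (X.TotalFrac x.1) (X.presheaf.germ U x.1 x.2 b) =
      algebraMap _ (X.TotalFrac x.1) (X.presheaf.germ U x.1 x.2 a)
  res {U V} i f := by
    rintro ⟨a, b, h⟩
    refine ⟨X.presheaf.map i.op a, X.presheaf.map i.op b, fun x => ?_⟩
    rw [TopCat.Presheaf.germ_res_apply, TopCat.Presheaf.germ_res_apply]
    exact h (i x)

/-- The local predicate on families `f x ∈ Frac(𝒪_{X,x})` of being locally a fraction. -/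
def isRationalFunction (X : Scheme.{u}) :
    TopCat.LocalPredicate (X := X.carrier) (X.TotalFrac) :=
  X.isFractionPrelocal.sheafify

/-- The ring of rational functions on an open set `U`. -/
def rationalFunctions (X : Scheme.{u}) (U : X.Opens) : Subring (∀ x : U, X.TotalFrac x.1) where
  carrier := { f | X.isRationalFunction.pred f }
  mul_mem' := by
    intro f g hf hg
    refine X.isFractionPrelocal.sheafify_inductionOn₂' X.isFractionPrelocal X.isFractionPrelocal
      (fun s t => s * t) ?_ hf hg
    rintro U V f g ⟨a, b, h⟩ ⟨c, d, k⟩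
    refine ⟨X.presheaf.map (homOfLE inf_le_left).op a * X.presheaf.map (homOfLE inf_le_right).op c,
      X.presheaf.map (homOfLE inf_le_left).op b * X.presheaf.map (homOfLE inf_le_right).op d,
      fun x => ?_⟩
    obtain ⟨h1, h2⟩ := h ⟨x.1, x.2.1⟩
    obtain ⟨k1, k2⟩ := k ⟨x.1, x.2.2⟩
    simp only [map_mul, TopCat.Presheaf.germ_res_apply]
    refine ⟨mul_mem h1 k1, ?_⟩
    rw [← h2, ← k2]
    ring
  add_mem' := by
    intro f g hf hg
    refine X.isFractionPrelocal.sheafify_inductionOn₂' X.isFractionPrelocal X.isFractionPrelocal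
      (fun s t => s + t) ?_ hf hg
    rintro U V f g ⟨a, b, h⟩ ⟨c, d, k⟩
    refine ⟨X.presheaf.map (homOfLE inf_le_left).op a * X.presheaf.map (homOfLE inf_le_right).op d
      + X.presheaf.map (homOfLE inf_le_left).op b * X.presheaf.map (homOfLE inf_le_right).op c,
      X.presheaf.map (homOfLE inf_le_left).op b * X.presheaf.map (homOfLE inf_le_right).op d,
      fun x => ?_⟩
    obtain ⟨h1, h2⟩ := h ⟨x.1, x.2.1⟩
    obtain ⟨k1, k2⟩ := k ⟨x.1, x.2.2⟩
    simp only [map_mul, map_add, TopCat.Presheaf.germ_res_apply]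
    refine ⟨mul_mem h1 k1, ?_⟩
    rw [← h2, ← k2]
    ring
  one_mem' := TopCat.PrelocalPredicate.sheafifyOf ⟨1, 1, fun x => by simp⟩
  zero_mem' := TopCat.PrelocalPredicate.sheafifyOf ⟨0, 1, fun x => by simp⟩
  neg_mem' := by
    intro f hf
    refine X.isFractionPrelocal.sheafify_inductionOn' (fun s => -s) ?_ hf
    rintro U f ⟨a, b, h⟩
    exact ⟨-a, b, fun x => ⟨(h x).1, by rw [map_neg, map_neg, ← (h x).2, neg_mul]⟩⟩

/-- The presheaf of rational functions. -/
def rationalPresheaf (X : Scheme.{u}) : (Opens X)ᵒᵖ ⥤ CommRingCat.{u} where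
  obj U := CommRingCat.of (X.rationalFunctions U.unop)
  map i := CommRingCat.ofHom
    { toFun := fun f => ⟨fun x => f.1 (i.unop x), X.isRationalFunction.res i.unop f.1 f.2⟩
      map_one' := rfl
      map_mul' := fun _ _ => rfl
      map_zero' := rfl
      map_add' := fun _ _ => rfl }

/-- The sheaf `ℳ_X` of rational functions: the sheaf associated with the presheaf
`U ↦ S(U)⁻¹ 𝒪_X(U)`, where `S(U)` is the set of sections all of whose germs are
non-zero-divisors. Its sections over `U` are given as families of elements of `Frac(𝒪_{X,x})`,
`x ∈ U`, that are locally quotients of sections of `𝒪_X`. -/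
def rationalSheaf (X : Scheme.{u}) :
    CategoryTheory.Sheaf (Opens.grothendieckTopology X) CommRingCat.{u} where
  obj := X.rationalPresheaf
  property := (TopCat.Presheaf.isSheaf_iff_isSheaf_comp (CategoryTheory.forget CommRingCat.{u})
      X.rationalPresheaf).mpr
    (TopCat.Presheaf.isSheaf_of_iso
      (NatIso.ofComponents (fun _ => Iso.refl _) :
        (TopCat.subsheafToTypes X.isRationalFunction).1 ≅
          X.rationalPresheaf ⋙ CategoryTheory.forget CommRingCat.{u})
      (TopCat.subsheafToTypes X.isRationalFunction).2)

/-- The homomorphism `𝒪_X(U) → ℳ_X(U)` sending `a` to the family `x ↦ aₓ / 1`. -/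
def toRationalFunctions (X : Scheme.{u}) (U : X.Opens) : Γ(X, U) →+* X.rationalFunctions U :=
  (RingHom.pi fun x : U => (algebraMap _ (X.TotalFrac x.1)).comp
    (X.presheaf.germ U x.1 x.2).hom).codRestrict _
    fun a => TopCat.PrelocalPredicate.sheafifyOf ⟨a, 1, fun x => ⟨by simp, by rw [map_one, map_one, mul_one]; rfl⟩⟩

/-- The structure sheaf `𝒪_X`. -/
abbrev structureSheaf (X : Scheme.{u}) :
    CategoryTheory.Sheaf (Opens.grothendieckTopology X) CommRingCat.{u} := X.sheaf

/-- The canonical homomorphism `𝒪_X → ℳ_X`. -/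
def toRationalSheaf (X : Scheme.{u}) : X.structureSheaf ⟶ X.rationalSheaf :=
  ⟨{ app := fun U => CommRingCat.ofHom (X.toRationalFunctions U.unop)
     naturality := fun U V i => by
      refine CommRingCat.hom_ext (RingHom.ext fun a => Subtype.ext (funext fun x => ?_))
      exact congrArg (algebraMap _ (X.TotalFrac x.1)) (X.presheaf.germ_res_apply i.unop x.1 x.2 a) }⟩

/-- The sheaf `𝒪_X^×`, written additively. -/
def unitsSheaf (X : Scheme.{u}) : X.ZarAb := X.unitsSheafFunctor.obj X.structureSheaf

/-- The sheaf `ℳ_X^×` of invertible rational functions, written additively. -/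
def rationalUnitsSheaf (X : Scheme.{u}) : X.ZarAb := X.unitsSheafFunctor.obj X.rationalSheaf

/-- The canonical homomorphism `𝒪_X^× → ℳ_X^×`. -/
def unitsToRational (X : Scheme.{u}) : X.unitsSheaf ⟶ X.rationalUnitsSheaf :=
  X.unitsSheafFunctor.map X.toRationalSheaf

/-- The sheaf of Cartier divisors `𝒟iv_X = ℳ_X^× / 𝒪_X^×`. -/
def cartierSheaf (X : Scheme.{u}) : X.ZarAb := cokernel X.unitsToRational

/-! ### Weil divisors -/

/-- An integral-valued function on an open set `U` that is non-zero at only finitely many points,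
all of them points of codimension one. -/
def isWeilPrelocal (X : Scheme.{u}) :
    TopCat.PrelocalPredicate (X := X.carrier) (fun _ => ℤ) where
  pred {U} D := {z : U | D z ≠ 0}.Finite ∧ ∀ z : U, D z ≠ 0 → Order.coheight z.1 = 1
  res {U V} i _ h :=
    ⟨Set.Finite.preimage (f := fun z : U => (⟨z.1, i.le z.2⟩ : V))
      (Set.injOn_of_injective fun _ _ e => Subtype.ext (Subtype.mk.inj e)) h.1,
      fun z hz => h.2 (i z) hz⟩

/-- The local predicate of being a Weil divisor: the support is locally finite and consists of
points of codimension one. A point `z` of codimension one stands for the prime divisor given by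
its closure. -/
def isWeil (X : Scheme.{u}) : TopCat.LocalPredicate (X := X.carrier) (fun _ => ℤ) :=
  X.isWeilPrelocal.sheafify

/-- The group `Z¹(U)` of Weil divisors on an open set `U`. -/
def weilDivisors (X : Scheme.{u}) (U : X.Opens) : AddSubgroup (U → ℤ) where
  carrier := { D | X.isWeil.pred D }
  add_mem' := by
    intro D E hD hE
    refine X.isWeilPrelocal.sheafify_inductionOn₂' X.isWeilPrelocal X.isWeilPrelocal
      (fun s t => s + t) ?_ hD hE
    intro U V D E hD hE
    have hD' := X.isWeilPrelocal.res (Opens.infLELeft U V) D hD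
    have hE' := X.isWeilPrelocal.res (Opens.infLERight U V) E hE
    have key : ∀ z : (U ⊓ V : X.Opens), D ⟨z, z.2.1⟩ + E ⟨z, z.2.2⟩ ≠ 0 →
        D ⟨z, z.2.1⟩ ≠ 0 ∨ E ⟨z, z.2.2⟩ ≠ 0 := by
      intro z hz
      by_contra! hc
      exact hz (by rw [hc.1, hc.2, add_zero])
    refine ⟨(hD'.1.union hE'.1).subset fun z hz => key z hz, fun z hz => ?_⟩
    rcases key z hz with h | h
    · exact hD'.2 z h
    · exact hE'.2 z h
  zero_mem' := TopCat.PrelocalPredicate.sheafifyOf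
    ⟨by simp, fun z hz => absurd rfl hz⟩
  neg_mem' := by
    intro D hD
    refine X.isWeilPrelocal.sheafify_inductionOn' (fun s => -s) ?_ hD
    intro U D hD
    simpa [isWeilPrelocal] using hD

/-- The presheaf of Weil divisors. -/
def weilPresheaf (X : Scheme.{u}) : (Opens X)ᵒᵖ ⥤ AddCommGrpCat.{u} where
  obj U := AddCommGrpCat.of (X.weilDivisors U.unop)
  map i := AddCommGrpCat.ofHom
    { toFun := fun D => ⟨fun x => D.1 (i.unop x), X.isWeil.res i.unop D.1 D.2⟩
      map_zero' := rfl
      map_add' := fun _ _ => rfl }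

/-- The sheaf `𝒵¹_X` of Weil divisors. -/
def weilSheaf (X : Scheme.{u}) : X.ZarAb where
  obj := X.weilPresheaf
  property := (TopCat.Presheaf.isSheaf_iff_isSheaf_comp (CategoryTheory.forget AddCommGrpCat.{u})
      X.weilPresheaf).mpr
    (TopCat.Presheaf.isSheaf_of_iso
      (NatIso.ofComponents (fun _ => Iso.refl _) :
        (TopCat.subsheafToTypes X.isWeil).1 ≅ X.weilPresheaf ⋙ CategoryTheory.forget AddCommGrpCat.{u})
      (TopCat.subsheafToTypes X.isWeil).2)

/-! ### The Weil divisor of an invertible rational function -/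

lemma finite_not_isUnit_germ (X : Scheme.{u}) [IsNoetherian X] [X.IsNormal] {U : X.Opens}
    (a : Γ(X, U)) (ha : ∀ x : U, X.presheaf.germ U x.1 x.2 a ≠ 0) :
    {z : U | Order.coheight z.1 = 1 ∧ ¬ IsUnit (X.presheaf.germ U z.1 z.2 a)}.Finite := by
  classical
  let C : Set X := ((X.basicOpen a : X.Opens) : Set X)ᶜ
  obtain ⟨S, hS, hcl, hirr, hC⟩ := NoetherianSpace.exists_finite_set_isClosed_irreducible
    (show IsClosed C from (X.basicOpen a).isOpen.isClosed_compl)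
  have hmem : ∀ z : U, ¬ IsUnit (X.presheaf.germ U z.1 z.2 a) ↔ z.1 ∈ C := by
    intro z
    change _ ↔ ¬ (z.1 ∈ X.basicOpen a)
    rw [X.mem_basicOpen a z.1 z.2]
  have key : ∀ z : U, Order.coheight z.1 = 1 → ¬ IsUnit (X.presheaf.germ U z.1 z.2 a) →
      ∃ t ∈ S, closure {z.1} = t := by
    intro z hz hu
    have hzC : z.1 ∈ C := (hmem z).1 hu
    rw [hC] at hzC
    obtain ⟨t, ht, hzt⟩ := hzC
    refine ⟨t, ht, ?_⟩
    have hgen := (hirr t ht).isGenericPoint_genericPoint_closure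
    rw [(hcl t ht).closure_eq] at hgen
    set w := (hirr t ht).genericPoint
    have hwz : w ⤳ z.1 := hgen.specializes hzt
    have hwU : w ∈ U := hwz.mem_open U.isOpen z.2
    have hwC : w ∈ C := by
      rw [hC]
      exact ⟨t, ht, hgen.mem⟩
    have hwu := (hmem ⟨w, hwU⟩).2 hwC
    have hle : z.1 ≤ w := hwz
    by_cases hlt : w ≤ z.1
    · have hzw : z.1 ⤳ w := hlt
      rw [← hgen.def]
      exact (hzw.antisymm hwz).eq ▸ rfl
    · exfalso
      have h1 : Order.coheight w + 1 ≤ Order.coheight z.1 :=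
        Order.coheight_add_one_le (lt_of_le_not_ge hle hlt)
      rw [hz] at h1
      have h0 : Order.coheight w ≤ (0 : ℕ) := by
        simpa using (ENat.add_le_add_iff_right (by simp)).1 (h1.trans (zero_add (1 : ℕ∞)).ge)
      have := krullDimLE_of_coheight_le h0
      have hf := Ring.KrullDimLE.isField_of_isDomain (R := X.presheaf.stalk w)
      obtain ⟨b, hb⟩ := hf.mul_inv_cancel (ha ⟨w, hwU⟩)
      exact hwu (IsUnit.of_mul_eq_one b hb)
  refine Set.Finite.of_finite_image (f := fun z : U => closure {z.1})
    (hS.subset ?_) ?_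
  · rintro _ ⟨z, ⟨hz, hu⟩, rfl⟩
    obtain ⟨t, ht, h⟩ := key z hz hu
    exact (show closure {z.1} ∈ S from h ▸ ht)
  · intro x _ y _ h
    exact Subtype.ext ((specializes_iff_closure_subset.2 h.ge).antisymm
      (specializes_iff_closure_subset.2 h.le)).eq

/-- The order of vanishing at a point `z`, on invertible elements of `Frac(𝒪_{X,z})`, written
multiplicatively. If `z` has codimension one, `𝒪_{X,z}` is a discrete valuation ring and
this is its normalised valuation; at all other points, it is trivial by convention. -/
def orderAt (X : Scheme.{u}) [IsNoetherian X] [X.IsNormal] (z : X) :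
    (X.TotalFrac z)ˣ →* Multiplicative ℤ :=
  open Classical in
  if hz : Order.coheight z = 1 then
    haveI : Ring.KrullDimLE 1 (X.presheaf.stalk z) := krullDimLE_of_coheight_le hz.le
    WithZero.unitsWithZeroEquiv.toMonoidHom.comp
      (Units.map (Ring.ordFrac (K := X.TotalFrac z) (X.presheaf.stalk z) :
        X.TotalFrac z →* WithZero (Multiplicative ℤ)))
  else 1

lemma orderAt_of_coheight_ne_one (X : Scheme.{u}) [IsNoetherian X] [X.IsNormal] {z : X}
    (hz : Order.coheight z ≠ 1) (f : (X.TotalFrac z)ˣ) : X.orderAt z f = 1 := by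
  simp [orderAt, hz]

lemma orderAt_of_isUnit (X : Scheme.{u}) [IsNoetherian X] [X.IsNormal] {z : X}
    {a b : X.presheaf.stalk z} (ha : IsUnit a) (hb : IsUnit b) (f : (X.TotalFrac z)ˣ)
    (h : f.1 * algebraMap _ (X.TotalFrac z) b = algebraMap _ (X.TotalFrac z) a) :
    X.orderAt z f = 1 := by
  by_cases hz : Order.coheight z = 1
  · have : Ring.KrullDimLE 1 (X.presheaf.stalk z) := krullDimLE_of_coheight_le hz.le
    have h' := congrArg (Ring.ordFrac (K := X.TotalFrac z) (X.presheaf.stalk z)) h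
    rw [map_mul, Ring.ordFrac_of_isUnit ha, Ring.ordFrac_of_isUnit hb, mul_one] at h'
    simp only [orderAt, hz, dite_true]
    have : Units.map (Ring.ordFrac (K := X.TotalFrac z) (X.presheaf.stalk z) :
        X.TotalFrac z →* WithZero (Multiplicative ℤ)) f = 1 := Units.ext h'
    rw [MonoidHom.comp_apply, this, map_one]
  · exact X.orderAt_of_coheight_ne_one hz f

/-- The value in `Frac(𝒪_{X,x})` of an invertible rational function on `U` at a point `x ∈ U`. -/
def unitValue (X : Scheme.{u}) (U : X.Opens) (x : U) :
    (X.rationalFunctions U)ˣ →* (X.TotalFrac x.1)ˣ :=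
  Units.map ((Pi.evalRingHom (fun x : U => X.TotalFrac x.1) x).comp
    (X.rationalFunctions U).subtype : X.rationalFunctions U →* X.TotalFrac x.1)

lemma isWeil_order (X : Scheme.{u}) [IsNoetherian X] [X.IsNormal] (U : X.Opens)
    (f : (X.rationalFunctions U)ˣ) :
    X.isWeil.pred fun z : U => (X.orderAt z.1 (X.unitValue U z f)).toAdd := by
  intro x
  obtain ⟨V, hxV, i, a, b, h⟩ := f.1.2 x
  have hb : ∀ y : V, X.presheaf.germ V y.1 y.2 b ≠ 0 := fun y => nonZeroDivisors.ne_zero (h y).1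
  have ha : ∀ y : V, X.presheaf.germ V y.1 y.2 a ≠ 0 := by
    intro y h0
    have h1 : (X.unitValue U (i y) f).1 * algebraMap _ (X.TotalFrac y.1)
        (X.presheaf.germ V y.1 y.2 b) = 0 := by
      rw [← map_zero (algebraMap (X.presheaf.stalk y.1) (X.TotalFrac y.1)), ← h0]
      exact (h y).2
    rw [Units.mul_right_eq_zero] at h1
    exact hb y ((IsFractionRing.to_map_eq_zero_iff).1 h1)
  have key : ∀ z : V, (X.orderAt z.1 (X.unitValue U (i z) f)).toAdd ≠ 0 →
      Order.coheight z.1 = 1 ∧ (¬ IsUnit (X.presheaf.germ V z.1 z.2 a) ∨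
        ¬ IsUnit (X.presheaf.germ V z.1 z.2 b)) := by
    intro z hz
    refine ⟨?_, ?_⟩
    · by_contra hc
      exact hz (congrArg Multiplicative.toAdd (X.orderAt_of_coheight_ne_one hc _))
    · by_contra! hc
      exact hz (congrArg Multiplicative.toAdd (X.orderAt_of_isUnit hc.1 hc.2 _ (h z).2))
  refine ⟨V, hxV, i, ?_, fun z hz => (key z hz).1⟩
  refine ((X.finite_not_isUnit_germ a ha).union (X.finite_not_isUnit_germ b hb)).subset ?_
  intro z hz
  obtain ⟨h1, h2 | h2⟩ := key z hz
  · exact Or.inl ⟨h1, h2⟩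
  · exact Or.inr ⟨h1, h2⟩

/-- The homomorphism `ℳ_X^×(U) → Z¹(U)` sending `f` to its divisor `z ↦ ord_z(f)`. -/
def divisor (X : Scheme.{u}) [IsNoetherian X] [X.IsNormal] (U : X.Opens) :
    Additive (X.rationalFunctions U)ˣ →+ X.weilDivisors U where
  toFun f := ⟨fun z => (X.orderAt z.1 (X.unitValue U z f.toMul)).toAdd, X.isWeil_order U f.toMul⟩
  map_zero' := Subtype.ext (funext fun z => by simp)
  map_add' f g := Subtype.ext (funext fun z => by simp)

/-- The homomorphism of sheaves `ℳ_X^× → 𝒵¹_X` sending `f` to its divisor. -/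
def divisorMap (X : Scheme.{u}) [IsNoetherian X] [X.IsNormal] :
    X.rationalUnitsSheaf ⟶ X.weilSheaf :=
  ⟨{ app := fun U => AddCommGrpCat.ofHom (X.divisor U.unop)
     naturality := fun _ _ _ => rfl }⟩

lemma unitsToRational_divisorMap (X : Scheme.{u}) [IsNoetherian X] [X.IsNormal] :
    X.unitsToRational ≫ X.divisorMap = 0 := by
  refine CategoryTheory.Sheaf.hom_ext (NatTrans.ext (funext fun U => ?_))
  refine AddCommGrpCat.hom_ext (AddMonoidHom.ext fun a => Subtype.ext (funext fun z => ?_))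
  let b : Γ(X, U.unop)ˣ := Additive.toMul (α := Γ(X, U.unop)ˣ) a
  refine congrArg Multiplicative.toAdd (X.orderAt_of_isUnit
    (b.isUnit.map (X.presheaf.germ U.unop z.1 z.2).hom) isUnit_one _ ?_)
  rw [map_one, mul_one]
  rfl

/-- The canonical homomorphism `𝒟iv_X → 𝒵¹_X` from Cartier divisors to Weil divisors. -/
def cartierToWeil (X : Scheme.{u}) [IsNoetherian X] [X.IsNormal] :
    X.cartierSheaf ⟶ X.weilSheaf :=
  cokernel.desc X.unitsToRational X.divisorMap X.unitsToRational_divisorMap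

/-- The quotient sheaf `𝒫_X = 𝒵¹_X / 𝒟iv_X`. -/
def quotientSheaf (X : Scheme.{u}) [IsNoetherian X] [X.IsNormal] : X.ZarAb :=
  cokernel X.cartierToWeil

/-- The sequence `𝒪_X^× → ℳ_X^× → 𝒟iv_X`. -/
def cartierSequence (X : Scheme.{u}) : ShortComplex X.ZarAb :=
  ShortComplex.mk X.unitsToRational (cokernel.π X.unitsToRational) (cokernel.condition _)

/-- The sequence `𝒟iv_X → 𝒵¹_X → 𝒫_X`. -/
def weilSequence (X : Scheme.{u}) [IsNoetherian X] [X.IsNormal] : ShortComplex X.ZarAb :=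
  ShortComplex.mk X.cartierToWeil (cokernel.π X.cartierToWeil) (cokernel.condition _)

/-! ### Global sections, class group and cohomology -/

/-- The group of global sections of a Zariski sheaf of abelian groups. -/
abbrev globalSections {X : Scheme.{u}} (F : X.ZarAb) : Type u := F.obj.obj (op (⊤ : Opens X))

/-- The homomorphism on global sections induced by a homomorphism of sheaves. -/
def globalSectionsMap {X : Scheme.{u}} {F G : X.ZarAb} (φ : F ⟶ G) : globalSections F →+ globalSections G :=
  (φ.hom.app (op ⊤)).hom

/-- The class group `Cl(X) = Z¹(X) / Div(X)`, the quotient of the group of Weil divisors by the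
image of the group of Cartier divisors. -/
abbrev ClassGroup (X : Scheme.{u}) [IsNoetherian X] [X.IsNormal] : Type u :=
  globalSections X.weilSheaf ⧸ (globalSectionsMap X.cartierToWeil).range

/-- The canonical homomorphism `Cl(X) → P(X)`, where `P(X) = Γ(X, 𝒫_X)`. -/
def classGroupToP (X : Scheme.{u}) [IsNoetherian X] [X.IsNormal] :
    X.ClassGroup →+ globalSections X.quotientSheaf :=
  QuotientAddGroup.lift _ (globalSectionsMap (cokernel.π X.cartierToWeil)) (by
    rintro _ ⟨D, rfl⟩
    have h := congrArg (fun ψ => globalSectionsMap ψ D) (cokernel.condition X.cartierToWeil)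
    exact h)

/-- The connecting homomorphism `Γ(X, S₃) → H¹(X, S₁)` of a short exact sequence
`0 → S₁ → S₂ → S₃ → 0` of sheaves. -/
def connecting₀ {X : Scheme.{u}} {S : ShortComplex X.ZarAb} (hS : S.ShortExact) :
    globalSections S.X₃ →+ Sheaf.H.{u} S.X₁ 1 :=
  (hS.extClass.postcomp _ (zero_add 1)).comp
    (Sheaf.H.equiv₀ S.X₃ (T := (⊤ : Opens X)) isTerminalTop).symm.toAddMonoidHom

/-- The connecting homomorphism `Hⁿ(X, S₃) → Hⁿ⁺¹(X, S₁)` of a short exact sequence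
`0 → S₁ → S₂ → S₃ → 0` of sheaves. -/
def connecting {X : Scheme.{u}} {S : ShortComplex X.ZarAb} (hS : S.ShortExact) (n : ℕ) :
    Sheaf.H.{u} S.X₃ n →+ Sheaf.H.{u} S.X₁ (n + 1) :=
  hS.extClass.postcomp _ rfl

end AlgebraicGeometry.Scheme

end

/-!
The sheaves `ℳ_X^×` and `𝒵¹_X` are flasque, hence acyclic, and the two short exact sequences then
identify the cohomology of `𝒪_X^×` by dimension shifting. Indeed `H¹(X, 𝒵¹_X) = 0` gives
`P(X) / im Z¹(X) ≃ H¹(X, 𝒟iv_X)`, and `H¹(X, ℳ_X^×) = H²(X, ℳ_X^×) = 0` shows that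
`H¹(X, 𝒟iv_X) → H²(X, 𝒪_X^×)` is bijective; the image of `Z¹(X)` in `P(X)` is that of `Cl(X)`.

*Exactness.* The only point is that `𝒟iv_X → 𝒵¹_X` is injective, i.e. that an invertible rational
function with trivial divisor is locally a unit (`exists_units_of_orderAt_eq_one`). A normal
noetherian scheme is covered by affine open sets `W` on which `Γ(X, W)` is an integrally closed
noetherian domain (`exists_isAffineOpen_isDomain`), and divisibility in such a domain can be tested
at the primes of height one (`dvd_of_forall_height_eq_one`): a prime `P = (b : c)` associated to
`(b)` has height one, because `c / b`, not being integral, cannot map `P` to itself, which makes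
`P` minimal over a principal ideal. At points of codimension one the local ring is a discrete
valuation ring, where order zero means unit.

*Flasqueness.* Weil divisors on an open subset of a noetherian scheme have finite support and extend
by zero (`isFlasque_weilSheaf`). Two rational functions on an irreducible open set which agree at
one point are equal (`rationalFunctions_ext_of_isPreirreducible`), so an invertible rational
function on an open set `V` is a single fraction of sections over `W` on the irreducible set `V ∩ W`, and this
fraction extends it to `V ∪ W`; noetherian induction concludes (`isFlasque_rationalUnitsSheaf`).

*Acyclicity.* Injective sheaves are flasque (`isFlasque_of_injective`) since the free sheaf on an
open subset embeds into the free sheaf on a larger one. Embedding a flasque sheaf into an injective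
one leaves a flasque quotient, onto whose global sections those of the injective sheaf surject; this
kills `H¹`, and by induction all higher cohomology (`subsingleton_H_of_isFlasque`).
-/

noncomputable section

open CategoryTheory TopologicalSpace Opposite Limits AlgebraicGeometry

/-! ### Divisibility and primes of height one -/

section DivisibilityInHeightOne

variable {A : Type*} [CommRing A] [IsDomain A] [IsNoetherianRing A] [IsIntegrallyClosed A]

/-- A prime `P = (b : c)` associated to a nonzero principal ideal `(b)` of a noetherian
integrally closed domain has height one. -/
lemma Ideal.height_eq_one_of_mem_iff_dvd_mul {b c : A} (hb : b ≠ 0) (P : Ideal A) [hP : P.IsPrime]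
    (hPc : ∀ p, p ∈ P ↔ b ∣ p * c) : P.height = 1 := by
  let K := FractionRing A
  have hbK : algebraMap A K b ≠ 0 := by simpa using hb
  have hbc : ¬ b ∣ c := fun h =>
    hP.ne_top ((Ideal.eq_top_iff_one _).2 ((hPc 1).2 (by simpa using h)))
  have hbP : b ∈ P := (hPc b).2 (dvd_mul_right b c)
  -- Multiplication by `c / b` does not map `P` into itself, since otherwise `c / b` would be
  -- integral over `A`.
  obtain ⟨p, hp, t, ht, hpt⟩ : ∃ p ∈ P, ∃ t, t ∉ P ∧ p * c = b * t := by
    by_contra! hcon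
    have hint : IsIntegral A (algebraMap A K c / algebraMap A K b) := by
      refine isIntegral_of_smul_mem_submodule (R := A) (A := K) (M := K)
        (Submodule.map (Algebra.linearMap A K) P) ?_ ?_ _ ?_
      · rw [Submodule.ne_bot_iff]
        exact ⟨algebraMap A K b, ⟨b, hbP, rfl⟩, hbK⟩
      · exact Submodule.FG.map _ (IsNoetherian.noetherian P)
      · rintro _ ⟨p, hp, rfl⟩
        obtain ⟨t, ht⟩ := (hPc p).1 hp
        have htP : t ∈ P := by
          by_contra h
          exact hcon p hp t h ht
        refine ⟨t, htP, ?_⟩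
        simp only [Algebra.linearMap_apply, smul_eq_mul]
        rw [div_mul_eq_mul_div, eq_div_iff hbK, ← map_mul, ← map_mul, mul_comm c, ht, mul_comm b]
    obtain ⟨y, hy⟩ := IsIntegrallyClosed.algebraMap_eq_of_integral hint
    rw [eq_div_iff hbK, ← map_mul] at hy
    exact hbc ⟨y, by rw [mul_comm b, IsFractionRing.injective A K hy]⟩
  -- Hence `t q ∈ (p)` for all `q ∈ P`, so `P` is minimal over the principal ideal `(p)`.
  have hmin : P ∈ (Ideal.span {p}).minimalPrimes := by
    refine ⟨⟨hP, (Ideal.span_singleton_le_iff_mem _).2 hp⟩, ?_⟩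
    rintro Q ⟨hQ, hpQ⟩ hQP q hq
    obtain ⟨r, hr⟩ := (hPc q).1 hq
    have h : t * q = r * p := by
      refine mul_left_cancel₀ hb ?_
      calc b * (t * q) = (p * c) * q := by rw [hpt]; ring
        _ = p * (q * c) := by ring
        _ = b * (r * p) := by rw [hr]; ring
    have hmem : t * q ∈ Q := by
      rw [h]
      exact Q.mul_mem_left _ ((Ideal.span_singleton_le_iff_mem _).1 hpQ)
    exact (hQ.mem_or_mem hmem).resolve_left fun h => ht (hQP h)
  refine le_antisymm (Ideal.height_le_one_of_isPrincipal_of_mem_minimalPrimes _ P hmin) ?_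
  rw [Order.one_le_iff_pos, pos_iff_ne_zero, Ne, Ideal.height_eq_zero_iff]
  rintro hP0
  have := hP0.2 (show (⊥ : Ideal A).IsPrime ∧ _ from ⟨Ideal.isPrime_bot, bot_le⟩) bot_le hbP
  exact hb (by simpa using this)

/-- A noetherian integrally closed domain is the intersection of its localizations at the primes
of height one. -/
lemma dvd_of_forall_height_eq_one {a b : A} (hb : b ≠ 0)
    (h : ∀ p : Ideal A, p.IsPrime → p.height = 1 → ∃ s ∉ p, b ∣ s * a) : b ∣ a := by
  by_contra hba
  obtain ⟨P, hP, hPa⟩ := exists_le_isAssociatedPrime_of_isNoetherianRing A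
    (Ideal.Quotient.mk (Ideal.span {b}) a)
    (by rwa [Ne, Ideal.Quotient.eq_zero_iff_mem, Ideal.mem_span_singleton])
  have key : ∀ x y : A, x ∈ (⊥ : Submodule A (A ⧸ Ideal.span {b})).colon
      {Ideal.Quotient.mk (Ideal.span {b}) y} ↔ b ∣ x * y := by
    intro x y
    rw [Submodule.mem_colon_singleton, Submodule.mem_bot, ← Ideal.mem_span_singleton,
      ← Ideal.Quotient.eq_zero_iff_mem]
    rfl
  obtain ⟨hPp, y, hy⟩ := (isAssociatedPrime_iff).1 hP
  obtain ⟨c, rfl⟩ := Ideal.Quotient.mk_surjective y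
  have h1 : P.height = 1 := P.height_eq_one_of_mem_iff_dvd_mul hb (c := c)
    fun p => by rw [hy]; exact key p c
  obtain ⟨s, hs, hsa⟩ := h P hPp h1
  exact hs (hPa ((key s a).2 hsa))

end DivisibilityInHeightOne

/-! ### Flasque sheaves are acyclic -/

lemma AddCommGrpCat.mono_free_map {S T : Type u} (f : S ⟶ T) [hf : Mono f] :
    Mono (AddCommGrpCat.free.map f) := by
  rw [CategoryTheory.mono_iff_injective] at hf
  -- An injective map out of a nonempty set has a retraction, which the free functor preserves.
  rcases isEmpty_or_nonempty S with h | h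
  · rw [AddCommGrpCat.mono_iff_injective]
    have : Subsingleton (FreeAbelianGroup S) := inferInstance
    exact fun x y _ => this.elim x y
  · have : IsSplitMono f := ⟨⟨⟨↾(Function.invFun f), by
      ext x
      exact Function.leftInverse_invFun hf x⟩⟩⟩
    infer_instance

namespace TopCat.Sheaf

variable {X : TopCat.{u}}

/-- The sheaf of abelian groups freely generated by an open set: the sheafification of
`W ↦ ℤ[Hom(W, U)]`, which is `ℤ` if `W ≤ U` and `0` otherwise. -/
def freeOpens : Opens X ⥤ CategoryTheory.Sheaf (Opens.grothendieckTopology X) AddCommGrpCat.{u} :=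
  yoneda ⋙ (Functor.whiskeringRight _ _ _).obj AddCommGrpCat.free ⋙ presheafToSheaf _ _

instance {U V : Opens X} (i : U ⟶ V) : Mono (freeOpens.map i) := by
  have : Mono (((Functor.whiskeringRight (Opens X)ᵒᵖ _ _).obj AddCommGrpCat.free.{u}).map
      (yoneda.map i)) := by
    have (W : (Opens X)ᵒᵖ) : Mono ((((Functor.whiskeringRight (Opens X)ᵒᵖ _ _).obj
        AddCommGrpCat.free.{u}).map (yoneda.map i)).app W) := by
      have : Mono ((yoneda.map i).app W) :=
        (CategoryTheory.mono_iff_injective _).2 fun a b _ =>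
          (inferInstance : Subsingleton (W.unop ⟶ U)).elim a b
      exact AddCommGrpCat.mono_free_map _
    exact NatTrans.mono_of_mono_app _
  exact inferInstanceAs (Mono ((presheafToSheaf _ _).map _))

/-- Morphisms out of the free sheaf on `U` correspond to sections over `U`. -/
def freeOpensHomEquiv (U : Opens X)
    (F : CategoryTheory.Sheaf (Opens.grothendieckTopology X) AddCommGrpCat.{u}) :
    (freeOpens.obj U ⟶ F) ≃ F.obj.obj (op U) :=
  ((sheafificationAdjunction _ _).homEquiv _ F).trans
    (((AddCommGrpCat.adj.whiskerRight _).homEquiv _ _).trans yonedaEquiv)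

lemma freeOpensHomEquiv_naturality {U V : Opens X} (i : U ⟶ V)
    (F : CategoryTheory.Sheaf (Opens.grothendieckTopology X) AddCommGrpCat.{u})
    (φ : freeOpens.obj V ⟶ F) :
    freeOpensHomEquiv U F (freeOpens.map i ≫ φ) = F.obj.map i.op (freeOpensHomEquiv V F φ) := by
  have h₁ := (sheafificationAdjunction (Opens.grothendieckTopology X)
    AddCommGrpCat.{u}).homEquiv_naturality_left
    (((Functor.whiskeringRight (Opens X)ᵒᵖ _ _).obj AddCommGrpCat.free.{u}).map (yoneda.map i)) φ
  have h₂ := (AddCommGrpCat.adj.{u}.whiskerRight (Opens X)ᵒᵖ).homEquiv_naturality_left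
    (yoneda.map i) ((sheafificationAdjunction (Opens.grothendieckTopology X)
    AddCommGrpCat.{u}).homEquiv _ F φ)
  exact ((congrArg (fun ψ => yonedaEquiv (((AddCommGrpCat.adj.{u}.whiskerRight
    (Opens X)ᵒᵖ).homEquiv _ _) ψ)) h₁).trans (congrArg yonedaEquiv h₂)).trans
    (yonedaEquiv_naturality _ _).symm

/-- Injective sheaves are flasque: sections extend along `U ≤ V` because the free sheaf on `U` is
a subsheaf of the free sheaf on `V`. -/
lemma isFlasque_of_injective
    (F : CategoryTheory.Sheaf (Opens.grothendieckTopology X) AddCommGrpCat.{u}) [Injective F] :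
    IsFlasque F where
  epi {V U} i := by
    rw [AddCommGrpCat.epi_iff_surjective]
    intro s
    refine ⟨freeOpensHomEquiv _ F (Injective.factorThru ((freeOpensHomEquiv _ F).symm s)
      (freeOpens.map i.unop)), ?_⟩
    have h := freeOpensHomEquiv_naturality i.unop F
      (Injective.factorThru ((freeOpensHomEquiv _ F).symm s) (freeOpens.map i.unop))
    rw [Injective.comp_factorThru, Equiv.apply_symm_apply] at h
    exact h.symm

open Abelian in
/-- Flasque sheaves are acyclic, by dimension shifting along an embedding into an injective. -/
lemma subsingleton_H_of_isFlasque (n : ℕ)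
    (F : CategoryTheory.Sheaf (Opens.grothendieckTopology X) AddCommGrpCat.{u})
    (hF : IsFlasque F) : Subsingleton (CategoryTheory.Sheaf.H.{u} F (n + 1)) := by
  induction n generalizing F with
  | zero =>
    refine subsingleton_of_forall_eq 0 fun x => ?_
    have hS : (ShortComplex.mk (Injective.ι F) (cokernel.π (Injective.ι F))
      (cokernel.condition _)).ShortExact := { exact := ShortComplex.exact_cokernel _ }
    obtain ⟨y, rfl⟩ := Ext.covariant_sequence_exact₁ _ hS x
      (Ext.eq_zero_of_injective _) (zero_add 1)
    have hT : IsTerminal (⊤ : Opens X) := isTerminalTop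
    have hepi := IsFlasque.epi_of_shortExact (U := ⊤) hS
    rw [AddCommGrpCat.epi_iff_surjective] at hepi
    -- A class in `H¹` comes from a global section of the quotient sheaf, and this section lifts.
    obtain ⟨z, hz⟩ := hepi (CategoryTheory.Sheaf.H.equiv₀ _ hT y)
    have hy : y = CategoryTheory.Sheaf.H.map (cokernel.π (Injective.ι F)) 0
        ((CategoryTheory.Sheaf.H.equiv₀ _ hT).symm z) := by
      rw [CategoryTheory.Sheaf.H.equiv₀_symm_naturality, AddEquiv.eq_symm_apply]
      exact hz.symm
    rw [hy, CategoryTheory.Sheaf.H.map_apply]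
    rw [Ext.comp_assoc _ _ _ (add_zero 0) (zero_add 1) (by lia), hS.comp_extClass, Ext.comp_zero]
  | succ n ih =>
    refine subsingleton_of_forall_eq 0 fun x => ?_
    have hS : (ShortComplex.mk (Injective.ι F) (cokernel.π (Injective.ι F))
      (cokernel.condition _)).ShortExact := { exact := ShortComplex.exact_cokernel _ }
    obtain ⟨y, rfl⟩ := Ext.covariant_sequence_exact₁ _ hS x
      (Ext.eq_zero_of_injective _) rfl
    have := isFlasque_of_injective (Injective.under F)
    have := ih _ (IsFlasque.of_shortExact_of_isFlasque₁₂ hS)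
    rw [Subsingleton.elim y 0, Ext.zero_comp]

end TopCat.Sheaf

/-! ### Integral affine open sets and points of codimension one -/

namespace AlgebraicGeometry.Scheme

variable {X : Scheme.{u}}

/-- On an affine open set with a domain of sections, germs are injective. -/
lemma germ_injective_of_isAffineOpen {W : X.Opens} (hW : IsAffineOpen W) [IsDomain Γ(X, W)]
    {z : X} (hz : z ∈ W) : Function.Injective (X.presheaf.germ W z hz) := by
  let := X.presheaf.algebra_section_stalk ⟨z, hz⟩
  have := hW.isLocalization_stalk ⟨z, hz⟩
  exact IsLocalization.injective (X.presheaf.stalk z)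
    (hW.primeIdealOf ⟨z, hz⟩).asIdeal.primeCompl_le_nonZeroDivisors

/-- Every germ at a point `z` of an affine open set `W` is a fraction of sections over `W`, since
`𝒪_{X,z}` is a localization of `Γ(X, W)`. -/
lemma exists_mul_germ_eq_germ {W : X.Opens} (hW : IsAffineOpen W) (z : W)
    (t : X.presheaf.stalk z.1) : ∃ a s : Γ(X, W), s ∉ (hW.primeIdealOf z).asIdeal ∧
      IsUnit (X.presheaf.germ W z.1 z.2 s) ∧
      t * X.presheaf.germ W z.1 z.2 s = X.presheaf.germ W z.1 z.2 a := by
  let := X.presheaf.algebra_section_stalk z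
  have := hW.isLocalization_stalk z
  obtain ⟨⟨a, s⟩, h⟩ := IsLocalization.surj (hW.primeIdealOf z).asIdeal.primeCompl t
  exact ⟨a, s.1, s.2, IsLocalization.map_units (X.presheaf.stalk z.1) s, h⟩

/-- Every element of `Frac(𝒪_{X,z})` is a fraction of sections over a given affine open
neighbourhood of `z`. -/
lemma exists_mul_germ_eq_germ_totalFrac {W : X.Opens} (hW : IsAffineOpen W) (z : W)
    [IsDomain (X.presheaf.stalk z.1)] (t : X.TotalFrac z.1) :
    ∃ a b : Γ(X, W), X.presheaf.germ W z.1 z.2 b ≠ 0 ∧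
      t * algebraMap _ (X.TotalFrac z.1) (X.presheaf.germ W z.1 z.2 b) =
        algebraMap _ (X.TotalFrac z.1) (X.presheaf.germ W z.1 z.2 a) := by
  obtain ⟨α, β, hβ, rfl⟩ := IsFractionRing.div_surjective (A := X.presheaf.stalk z.1) t
  obtain ⟨a, s, -, hs, ha⟩ := exists_mul_germ_eq_germ hW z α
  obtain ⟨b, r, -, hr, hb⟩ := exists_mul_germ_eq_germ hW z β
  have hβ0 := nonZeroDivisors.ne_zero hβ
  have hβK : algebraMap _ (X.TotalFrac z.1) β ≠ 0 := by simpa using hβ0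
  refine ⟨a * r, b * s, ?_, ?_⟩
  · rw [map_mul, ← hb]
    exact mul_ne_zero (mul_ne_zero hβ0 hr.ne_zero) hs.ne_zero
  · have h₁ : X.presheaf.germ W z.1 z.2 (b * s) =
        β * X.presheaf.germ W z.1 z.2 r * X.presheaf.germ W z.1 z.2 s := by rw [map_mul, hb]
    have h₂ : X.presheaf.germ W z.1 z.2 (a * r) =
        α * X.presheaf.germ W z.1 z.2 s * X.presheaf.germ W z.1 z.2 r := by rw [map_mul, ha]
    rw [h₁, h₂, div_mul_eq_mul_div, div_eq_iff hβK, ← map_mul, ← map_mul]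
    congr 1
    ring

lemma isPreirreducible_of_isAffineOpen {W : X.Opens} (hW : IsAffineOpen W) [IsDomain Γ(X, W)] :
    IsPreirreducible (W : Set X) := by
  have : IrreducibleSpace (Spec Γ(X, W)) :=
    inferInstanceAs (IrreducibleSpace (PrimeSpectrum Γ(X, W)))
  rw [← hW.range_fromSpec, ← Set.image_univ]
  exact (PreirreducibleSpace.isPreirreducible_univ).image _ hW.fromSpec.continuous.continuousOn

/-- A normal noetherian scheme is locally integral. -/
lemma exists_isAffineOpen_isDomain [IsNoetherian X] [X.IsNormal] {U : X.Opens} {x : X}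
    (hx : x ∈ U) :
    ∃ W ≤ U, x ∈ W ∧ IsAffineOpen W ∧ IsDomain Γ(X, W) := by
  obtain ⟨W, hxW, hW, hWU, hinj⟩ := X.exists_le_and_germ_injective x U hx
  exact ⟨W, hWU, hxW, hW, Function.Injective.isDomain (X.presheaf.germ W x hxW).hom hinj⟩

lemma isIntegrallyClosed_of_isAffineOpen [X.IsNormal] {W : X.Opens} (hW : IsAffineOpen W)
    [IsDomain Γ(X, W)] : IsIntegrallyClosed Γ(X, W) := by
  refine IsIntegrallyClosed.of_localization_maximal fun p _ hp => ?_
  have hz : hW.fromSpec ⟨p, hp.isPrime⟩ ∈ W := (hW.isoSpec.inv _).2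
  let : Algebra Γ(X, W) (X.presheaf.stalk (hW.fromSpec ⟨p, hp.isPrime⟩)) :=
    X.presheaf.algebra_section_stalk ⟨_, hz⟩
  have : IsLocalization p.primeCompl (X.presheaf.stalk (hW.fromSpec ⟨p, hp.isPrime⟩)) :=
    hW.isLocalization_stalk' ⟨p, hp.isPrime⟩ hz
  exact IsIntegrallyClosed.of_equiv (IsLocalization.algEquiv p.primeCompl
    (X.presheaf.stalk (hW.fromSpec ⟨p, hp.isPrime⟩)) (Localization.AtPrime p)).toRingEquiv

variable [IsNoetherian X] [X.IsNormal]

/-- The local ring at a point of codimension one is a discrete valuation ring. -/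
lemma isDiscreteValuationRing_stalk {z : X} (hz : Order.coheight z = 1) :
    IsDiscreteValuationRing (X.presheaf.stalk z) := by
  have hdim := ringKrullDim_stalk_eq_coheight z
  rw [hz] at hdim
  have hf : ¬ IsField (X.presheaf.stalk z) := by
    intro h
    rw [ringKrullDim_eq_zero_of_isField h] at hdim
    exact absurd hdim (by decide)
  have : Ring.KrullDimLE 1 (X.presheaf.stalk z) := krullDimLE_of_coheight_le hz.le
  have : IsDedekindDomain (X.presheaf.stalk z) :=
    { IsNormal.isIntegrallyClosed_stalk z with
      maximalOfPrime := Ring.krullDimLE_one_iff_of_noZeroDivisors.1 this _ }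
  exact ((IsDiscreteValuationRing.TFAE _ hf).out 0 2).2 this

/-- An element of order zero at a point of codimension one is a unit of the local ring. -/
lemma exists_unit_of_orderAt_eq_one {z : X} (hz : Order.coheight z = 1) (f : (X.TotalFrac z)ˣ)
    (hf : X.orderAt z f = 1) :
    ∃ u : X.presheaf.stalk z, IsUnit u ∧ algebraMap _ (X.TotalFrac z) u = f.1 := by
  have : Ring.KrullDimLE 1 (X.presheaf.stalk z) := krullDimLE_of_coheight_le hz.le
  have := isDiscreteValuationRing_stalk hz
  have h1 : Ring.ordFrac (K := X.TotalFrac z) (X.presheaf.stalk z) f.1 = 1 := by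
    simp only [orderAt, hz, dite_true] at hf
    have h2 := (MulEquiv.map_eq_one_iff WithZero.unitsWithZeroEquiv).1 hf
    exact congrArg Units.val h2
  have h2 : f.1 ∈ MonoidHom.mker (Ring.ordFrac (K := X.TotalFrac z) (X.presheaf.stalk z)) := h1
  rw [Ring.mker_ordFrac_eq_isUnitSubmonoid] at h2
  exact h2

end AlgebraicGeometry.Scheme

/-! ### Exactness of the two sequences -/

namespace AlgebraicGeometry.Scheme

variable {X : Scheme.{u}}

lemma toRationalFunctions_injective (U : X.Opens) :
    Function.Injective (X.toRationalFunctions U) := by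
  intro a b hab
  refine TopCat.Presheaf.section_ext X.sheaf U _ _ fun x hx => ?_
  refine IsFractionRing.injective (X.presheaf.stalk x) (X.TotalFrac x) ?_
  exact congrFun (congrArg Subtype.val hab) ⟨x, hx⟩

lemma unitsToRational_app_injective (U : X.Opens) :
    Function.Injective (X.unitsToRational.hom.app (op U)) := by
  intro a b hab
  have h : (Additive.toMul (α := Γ(X, U)ˣ) a) = Additive.toMul (α := Γ(X, U)ˣ) b :=
    Units.map_injective (f := (X.toRationalFunctions U : Γ(X, U) →* X.rationalFunctions U))
      (toRationalFunctions_injective U) hab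
  exact h

instance : Mono X.unitsToRational := by
  refine (sheafToPresheaf _ _).mono_of_mono_map ?_
  have (U : (Opens X)ᵒᵖ) : Mono (((sheafToPresheaf (Opens.grothendieckTopology X)
      AddCommGrpCat.{u}).map X.unitsToRational).app U) :=
    (AddCommGrpCat.mono_iff_injective _).2 (unitsToRational_app_injective U.unop)
  exact NatTrans.mono_of_mono_app _

lemma shortExact_cartierSequence : X.cartierSequence.ShortExact where
  exact := ShortComplex.exact_cokernel _
  mono_f := inferInstanceAs (Mono X.unitsToRational)
  epi_g := inferInstanceAs (Epi (cokernel.π X.unitsToRational))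

variable [IsNoetherian X] [X.IsNormal]

/-- On an integral affine open set, a quotient of two sections is regular if it is so at all points
of codimension one. -/
lemma dvd_of_forall_coheight_eq_one {W : X.Opens} (hW : IsAffineOpen W) [IsDomain Γ(X, W)]
    {a b : Γ(X, W)} (hb : b ≠ 0) (h : ∀ z : W, Order.coheight z.1 = 1 →
      X.presheaf.germ W z.1 z.2 b ∣ X.presheaf.germ W z.1 z.2 a) : b ∣ a := by
  have := isIntegrallyClosed_of_isAffineOpen hW
  have : IsNoetherianRing Γ(X, W) := IsLocallyNoetherian.component_noetherian ⟨W, hW⟩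
  refine dvd_of_forall_height_eq_one hb fun p hp hp1 => ?_
  have hz : hW.fromSpec ⟨p, hp⟩ ∈ W := (hW.isoSpec.inv _).2
  have hz1 : Order.coheight (hW.fromSpec ⟨p, hp⟩) = 1 := by
    refine (coheight_eq_of_isOpenImmersion hW.fromSpec).trans ?_
    exact (idealHeight_eq_coheight Γ(X, W) ⟨p, hp⟩).symm.trans hp1
  obtain ⟨t, ht⟩ := h ⟨_, hz⟩ hz1
  let : Algebra Γ(X, W) (X.presheaf.stalk (hW.fromSpec ⟨p, hp⟩)) :=
    X.presheaf.algebra_section_stalk ⟨_, hz⟩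
  have : IsLocalization p.primeCompl (X.presheaf.stalk (hW.fromSpec ⟨p, hp⟩)) :=
    hW.isLocalization_stalk' ⟨p, hp⟩ hz
  obtain ⟨⟨r, s⟩, hrs⟩ := IsLocalization.surj p.primeCompl t
  refine ⟨s.1, s.2, r, germ_injective_of_isAffineOpen hW hz ?_⟩
  rw [map_mul, map_mul, ht]
  exact (mul_left_comm _ _ _).trans
    (congrArg (X.presheaf.germ W _ hz b * ·) ((mul_comm _ _).trans hrs))

/-- An invertible rational function with trivial divisor is locally a unit. -/
lemma exists_units_of_orderAt_eq_one {U : X.Opens} (f : (X.rationalFunctions U)ˣ)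
    (hf : ∀ z : U, X.orderAt z.1 (X.unitValue U z f) = 1) (x : U) :
    ∃ (W : X.Opens) (i : W ≤ U) (_ : x.1 ∈ W) (v : Γ(X, W)ˣ), ∀ z : W,
      f.1.1 ⟨z.1, i z.2⟩ = algebraMap _ (X.TotalFrac z.1) (X.presheaf.germ W z.1 z.2 v.1) := by
  obtain ⟨V, hxV, i, a₀, b₀, h₀⟩ := f.1.2 x
  obtain ⟨W, hWV, hxW, hW, hdom⟩ := exists_isAffineOpen_isDomain hxV
  obtain ⟨a, b, h⟩ := X.isFractionPrelocal.res (homOfLE hWV) _ ⟨a₀, b₀, h₀⟩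
  have hb : ∀ z : W, X.presheaf.germ W z.1 z.2 b ≠ 0 := fun z => nonZeroDivisors.ne_zero (h z).1
  have hbK : ∀ z : W, algebraMap _ (X.TotalFrac z.1) (X.presheaf.germ W z.1 z.2 b) ≠ 0 := by
    intro z
    simpa using hb z
  have hWU : W ≤ U := hWV.trans i.le
  have hf' : ∀ z : W, f.1.1 ⟨z.1, hWU z.2⟩ * algebraMap _ (X.TotalFrac z.1)
      (X.presheaf.germ W z.1 z.2 b) = algebraMap _ (X.TotalFrac z.1)
        (X.presheaf.germ W z.1 z.2 a) := fun z => (h z).2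
  -- Triviality of the order at the points of codimension one makes numerator and denominator
  -- associated there, hence each divides the other in `Γ(X, W)`.
  have key : ∀ z : W, Order.coheight z.1 = 1 → Associated (X.presheaf.germ W z.1 z.2 b)
      (X.presheaf.germ W z.1 z.2 a) := by
    intro z hz
    obtain ⟨v, hv, hvf⟩ := exists_unit_of_orderAt_eq_one hz _ (hf ⟨z.1, hWU z.2⟩)
    refine ⟨hv.unit, IsFractionRing.injective _ (X.TotalFrac z.1) ?_⟩
    rw [← hf' z, IsUnit.unit_spec, map_mul, hvf, mul_comm]
    rfl
  have hb0 : b ≠ 0 := fun e => hb ⟨x.1, hxW⟩ (by rw [e, map_zero])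
  have hba : b ∣ a := dvd_of_forall_coheight_eq_one hW hb0 fun z hz => (key z hz).dvd
  have ha0 : a ≠ 0 := by
    rintro rfl
    have h1 := hf' ⟨x.1, hxW⟩
    rw [map_zero, map_zero, mul_eq_zero] at h1
    refine h1.elim (fun h2 => ?_) (hbK _)
    exact (X.unitValue U x f).ne_zero h2
  have hab : a ∣ b := dvd_of_forall_coheight_eq_one hW ha0 fun z hz => (key z hz).symm.dvd
  obtain ⟨v, hv⟩ := associated_of_dvd_dvd hba hab
  refine ⟨W, hWU, hxW, v, fun z => mul_right_cancel₀ (hbK z) ?_⟩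
  rw [hf', ← map_mul, ← map_mul, mul_comm, hv]

/-- The sequence `𝒪_X^× → ℳ_X^× → 𝒵¹_X` is exact: locally, an invertible rational function with
trivial divisor is a unit. -/
lemma exact_unitsToRational_divisorMap :
    (ShortComplex.mk X.unitsToRational X.divisorMap X.unitsToRational_divisorMap).Exact := by
  rw [ShortComplex.exact_iff_epi_kernel_lift]
  refine (TopCat.Sheaf.isLocallySurjective_iff_epi _).1 ?_
  rw [TopCat.Presheaf.isLocallySurjective_iff]
  intro U s x hx
  -- A section of the kernel sheaf is a rational function with trivial divisor.
  let ι := kernel.ι X.divisorMap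
  let f : (X.rationalFunctions U)ˣ := Additive.toMul (α := (X.rationalFunctions U)ˣ)
    (ι.hom.app (op U) s)
  have hf : ∀ z : U, X.orderAt z.1 (X.unitValue U z f) = 1 := by
    intro z
    have h := congrArg (fun ψ => ψ.hom.app (op U) s) (kernel.condition X.divisorMap)
    exact congrFun (congrArg Subtype.val h) z
  obtain ⟨W, i, hxW, v, hv⟩ := exists_units_of_orderAt_eq_one f hf ⟨x, hx⟩
  refine ⟨W, i, ⟨Additive.ofMul v, ?_⟩, hxW⟩
  have hinj : Function.Injective (ι.hom.app (op W)) := by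
    rw [← AddCommGrpCat.mono_iff_injective]
    infer_instance
  apply hinj
  have h₁ := congrArg (fun ψ => ψ.hom.app (op W) (Additive.ofMul v))
    (kernel.lift_ι X.divisorMap X.unitsToRational X.unitsToRational_divisorMap)
  have h₂ := congrArg (fun ψ => ψ s) (ι.hom.naturality (homOfLE i).op)
  refine h₁.trans (Eq.trans ?_ h₂.symm)
  refine congrArg Additive.ofMul (Units.ext (Subtype.ext (funext fun z => ?_)))
  exact (hv z).symm

instance : Mono X.cartierToWeil := by
  have h := (ShortComplex.exact_iff_mono_cokernel_desc _).1
    (exact_unitsToRational_divisorMap (X := X))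
  unfold cartierToWeil
  exact h

lemma shortExact_weilSequence : X.weilSequence.ShortExact where
  exact := ShortComplex.exact_cokernel _
  mono_f := inferInstanceAs (Mono X.cartierToWeil)
  epi_g := inferInstanceAs (Epi (cokernel.π X.cartierToWeil))

end AlgebraicGeometry.Scheme

/-! ### Flasqueness of Weil divisors and of invertible rational functions -/

namespace AlgebraicGeometry.Scheme

variable {X : Scheme.{u}}

lemma isFlasque_of_surjective_top (F : X.ZarAb)
    (h : ∀ U : Opens X, Function.Surjective (F.obj.map (homOfLE (le_top : U ≤ ⊤)).op)) :
    TopCat.Sheaf.IsFlasque F where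
  epi {U V} i := by
    have h₁ : Epi (F.obj.map (homOfLE (le_top : V.unop ≤ ⊤)).op) :=
      (AddCommGrpCat.epi_iff_surjective _).2 (h V.unop)
    have h₂ : F.obj.map (homOfLE (le_top : V.unop ≤ ⊤)).op =
        F.obj.map (homOfLE (le_top : U.unop ≤ ⊤)).op ≫ F.obj.map i := by
      rw [← Functor.map_comp]
      rfl
    rw [h₂] at h₁
    exact epi_of_epi (F.obj.map (homOfLE (le_top : U.unop ≤ ⊤)).op) _

/-- On a noetherian scheme, Weil divisors on an open set have finite support, so that they can be
extended by zero. -/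
lemma isFlasque_weilSheaf [IsNoetherian X] : TopCat.Sheaf.IsFlasque X.weilSheaf := by
  classical
  refine isFlasque_of_surjective_top _ fun U D => ?_
  let D₀ : U → ℤ := D.1
  have hD : X.isWeil.pred D₀ := D.2
  let E : X → ℤ := fun z => if hz : z ∈ U then D₀ ⟨z, hz⟩ else 0
  have hE : ∀ z : U, E z.1 = D₀ z := fun z => dif_pos z.2
  have hcodim : ∀ z, E z ≠ 0 → Order.coheight z = 1 := by
    intro z hz
    by_cases hzU : z ∈ U
    · rw [hE ⟨z, hzU⟩] at hz
      obtain ⟨V, hzV, i, -, h⟩ := hD ⟨z, hzU⟩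
      exact h ⟨z, hzV⟩ hz
    · exact absurd (dif_neg hzU) hz
  choose V hV i hfin _ using hD
  have hcomp : IsCompact (U : Set X) := NoetherianSpace.isCompact _
  obtain ⟨t, ht⟩ := hcomp.elim_finite_subcover (fun x : U => (V x : Set X))
    (fun x => (V x).isOpen) fun x hx => Set.mem_iUnion.2 ⟨⟨x, hx⟩, hV ⟨x, hx⟩⟩
  have hsupp : {z | E z ≠ 0}.Finite := by
    refine (t.finite_toSet.biUnion fun x _ => (hfin x).image Subtype.val).subset fun z hz => ?_
    have hzU : z ∈ U := by
      by_contra hzU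
      exact hz (dif_neg hzU)
    obtain ⟨x, hxt, hzx⟩ := Set.mem_iUnion₂.1 (ht hzU)
    refine Set.mem_iUnion₂.2 ⟨x, hxt, ⟨z, hzx⟩, ?_, rfl⟩
    change D₀ _ ≠ 0
    rw [← hE]
    exact hz
  have hpred : X.isWeilPrelocal.pred fun z : (⊤ : Opens X) => E z.1 :=
    ⟨hsupp.preimage Subtype.val_injective.injOn, fun z => hcodim z.1⟩
  exact ⟨⟨fun z => E z.1, TopCat.PrelocalPredicate.sheafifyOf hpred⟩, Subtype.ext (funext hE)⟩

variable [X.IsNormal]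

/-- A rational function without zeros is invertible. -/
lemma isUnit_rationalFunctions {U : X.Opens} (f : X.rationalFunctions U) (hf : ∀ x, f.1 x ≠ 0) :
    IsUnit f := by
  refine IsUnit.of_mul_eq_one ⟨fun x => (f.1 x)⁻¹, fun x => ?_⟩
    (Subtype.ext (funext fun x => mul_inv_cancel₀ (hf x)))
  obtain ⟨V, hxV, i, a, b, h⟩ := f.2 x
  refine ⟨V, hxV, i, b, a, fun z => ?_⟩
  obtain ⟨h₁, h₂⟩ := h z
  replace h₂ : f.1 (i z) * algebraMap _ (X.TotalFrac z.1) (X.presheaf.germ V z.1 z.2 b) =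
    algebraMap _ (X.TotalFrac z.1) (X.presheaf.germ V z.1 z.2 a) := h₂
  refine ⟨mem_nonZeroDivisors_of_ne_zero fun h₀ => ?_, ?_⟩
  · rw [h₀, map_zero, mul_eq_zero] at h₂
    exact h₂.elim (hf _) (by simpa using nonZeroDivisors.ne_zero h₁)
  · change (f.1 (i z))⁻¹ * _ = _
    rw [← h₂, inv_mul_cancel_left₀ (hf _)]

variable [IsNoetherian X]

/-- Whether two rational functions agree at a point is locally independent of the point, because
germs are injective on integral affine open sets. -/
lemma exists_forall_eq_iff {U : X.Opens} (f g : X.rationalFunctions U) (x : U) :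
    ∃ (W : X.Opens) (i : W ≤ U), x.1 ∈ W ∧ ∀ z : W, f.1 ⟨z.1, i z.2⟩ = g.1 ⟨z.1, i z.2⟩ ↔
      f.1 x = g.1 x := by
  obtain ⟨V₁, hx₁, i₁, a₁, b₁, h₁⟩ := f.2 x
  obtain ⟨V₂, hx₂, i₂, a₂, b₂, h₂⟩ := g.2 x
  obtain ⟨W, hWV, hxW, hW, hdom⟩ := exists_isAffineOpen_isDomain (U := V₁ ⊓ V₂) ⟨hx₁, hx₂⟩
  obtain ⟨a, b, h⟩ := X.isFractionPrelocal.res (homOfLE (hWV.trans inf_le_left)) _ ⟨a₁, b₁, h₁⟩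
  obtain ⟨c, d, k⟩ := X.isFractionPrelocal.res (homOfLE (hWV.trans inf_le_right)) _ ⟨a₂, b₂, h₂⟩
  have hWU : W ≤ U := (hWV.trans inf_le_left).trans i₁.le
  have key : ∀ z : W, f.1 ⟨z.1, hWU z.2⟩ = g.1 ⟨z.1, hWU z.2⟩ ↔ a * d = c * b := by
    intro z
    have hb : algebraMap _ (X.TotalFrac z.1) (X.presheaf.germ W z.1 z.2 b) ≠ 0 := by
      simpa using nonZeroDivisors.ne_zero (h z).1
    have hd : algebraMap _ (X.TotalFrac z.1) (X.presheaf.germ W z.1 z.2 d) ≠ 0 := by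
      simpa using nonZeroDivisors.ne_zero (k z).1
    have hf : f.1 ⟨z.1, hWU z.2⟩ = _ := eq_div_of_mul_eq hb (h z).2
    have hg : g.1 ⟨z.1, hWU z.2⟩ = _ := eq_div_of_mul_eq hd (k z).2
    rw [hf, hg, div_eq_div_iff hb hd, ← map_mul, ← map_mul, ← map_mul, ← map_mul,
      (IsFractionRing.injective (X.presheaf.stalk z.1) (X.TotalFrac z.1)).eq_iff,
      (germ_injective_of_isAffineOpen hW z.2).eq_iff]
  exact ⟨W, hWU, hxW, fun z => (key z).trans (key ⟨x.1, hxW⟩).symm⟩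

/-- The identity principle for rational functions. -/
lemma rationalFunctions_ext_of_isPreirreducible {U : X.Opens}
    (hU : IsPreirreducible (U : Set X)) (f g : X.rationalFunctions U) (x : U)
    (hx : f.1 x = g.1 x) : f = g := by
  refine Subtype.ext (funext fun y => ?_)
  obtain ⟨W₁, i₁, hx₁, h₁⟩ := exists_forall_eq_iff f g x
  obtain ⟨W₂, i₂, hy₂, h₂⟩ := exists_forall_eq_iff f g y
  obtain ⟨z, -, hz₁, hz₂⟩ := hU W₁ W₂ W₁.isOpen W₂.isOpen ⟨x.1, x.2, hx₁⟩ ⟨y.1, y.2, hy₂⟩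
  exact (h₂ ⟨z, hz₂⟩).1 ((h₁ ⟨z, hz₁⟩).2 hx)

/-- A rational function without zeros on `V` extends to an integral affine open set `W`: since
`V ∩ W` is irreducible, the function is a single fraction of sections over `W` on it. -/
lemma exists_extension_isAffineOpen {V W : X.Opens} (hW : IsAffineOpen W) [IsDomain Γ(X, W)]
    (f : X.rationalFunctions V) (hf : ∀ x, f.1 x ≠ 0) :
    ∃ g : X.rationalFunctions W, (∀ x, g.1 x ≠ 0) ∧
      ∀ z (hV : z ∈ V) (hW : z ∈ W), f.1 ⟨z, hV⟩ = g.1 ⟨z, hW⟩ := by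
  by_cases hne : ∃ y, y ∈ V ∧ y ∈ W
  · obtain ⟨y, hyV, hyW⟩ := hne
    obtain ⟨a, b, hb, hab⟩ := exists_mul_germ_eq_germ_totalFrac hW ⟨y, hyW⟩ (f.1 ⟨y, hyV⟩)
    have hb0 : b ≠ 0 := by
      rintro rfl
      exact hb (map_zero _)
    have ha0 : a ≠ 0 := by
      rintro rfl
      rw [map_zero, map_zero, mul_eq_zero] at hab
      exact hab.elim (hf _) (by simpa using hb)
    have hgerm : ∀ (c : Γ(X, W)) (_ : c ≠ 0) (z : W), algebraMap _ (X.TotalFrac z.1)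
        (X.presheaf.germ W z.1 z.2 c) ≠ 0 := by
      intro c hc z
      have := (map_ne_zero_iff (X.presheaf.germ W z.1 z.2).hom
        (germ_injective_of_isAffineOpen hW z.2)).2 hc
      simpa using this
    have hpred : X.isFractionPrelocal.pred fun z : W => algebraMap _ (X.TotalFrac z.1)
        (X.presheaf.germ W z.1 z.2 a) / algebraMap _ (X.TotalFrac z.1)
          (X.presheaf.germ W z.1 z.2 b) :=
      ⟨a, b, fun z => ⟨mem_nonZeroDivisors_of_ne_zero fun h => hgerm b hb0 z (by rw [h, map_zero]),
        div_mul_cancel₀ _ (hgerm b hb0 z)⟩⟩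
    let g : X.rationalFunctions W := ⟨_, TopCat.PrelocalPredicate.sheafifyOf hpred⟩
    refine ⟨g, fun z => div_ne_zero (hgerm a ha0 z) (hgerm b hb0 z), fun z hzV hzW => ?_⟩
    let f' : X.rationalFunctions (V ⊓ W) :=
      ⟨fun z => f.1 ⟨z.1, z.2.1⟩, X.isRationalFunction.res (Opens.infLELeft V W) f.1 f.2⟩
    let g' : X.rationalFunctions (V ⊓ W) :=
      ⟨fun z => g.1 ⟨z.1, z.2.2⟩, X.isRationalFunction.res (Opens.infLERight V W) g.1 g.2⟩
    have hirr : IsPreirreducible ((V ⊓ W : X.Opens) : Set X) :=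
      (isPreirreducible_of_isAffineOpen hW).open_subset (V ⊓ W).isOpen inf_le_right
    have hfg : f' = g' := rationalFunctions_ext_of_isPreirreducible hirr f' g' ⟨y, hyV, hyW⟩
      (eq_div_of_mul_eq (hgerm b hb0 ⟨y, hyW⟩) hab)
    exact congrFun (congrArg Subtype.val hfg) ⟨z, hzV, hzW⟩
  · exact ⟨1, fun _ => one_ne_zero, fun z hzV hzW => absurd ⟨z, hzV, hzW⟩ hne⟩

/-- A rational function without zeros extends from any open set to the whole noetherian normal
scheme, by noetherian induction on its domain. -/
lemma exists_extension_top (V : X.Opens) (f : X.rationalFunctions V) (hf : ∀ x, f.1 x ≠ 0) :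
    ∃ g : X.rationalFunctions ⊤, (∀ x, g.1 x ≠ 0) ∧ ∀ z : V, g.1 ⟨z.1, trivial⟩ = f.1 z := by
  classical
  induction V using WellFoundedGT.induction with
  | ind V ih =>
    by_cases hV : V = ⊤
    · subst hV
      exact ⟨f, hf, fun z => rfl⟩
    obtain ⟨x, hx⟩ : ∃ x, x ∉ V := by
      by_contra! h
      exact hV (top_unique fun x _ => h x)
    obtain ⟨W, -, hxW, hW, hdom⟩ :=
      exists_isAffineOpen_isDomain (U := (⊤ : X.Opens)) (x := x) trivial
    obtain ⟨g, hg, hfg⟩ := exists_extension_isAffineOpen hW f hf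
    let h : ∀ z : (V ⊔ W : X.Opens), X.TotalFrac z.1 := fun z =>
      if hz : z.1 ∈ V then f.1 ⟨z.1, hz⟩ else g.1 ⟨z.1, z.2.resolve_left hz⟩
    have hhf : ∀ z : V, h ⟨z.1, Or.inl z.2⟩ = f.1 z := fun z => dif_pos z.2
    have hhg : ∀ z : W, h ⟨z.1, Or.inr z.2⟩ = g.1 z := by
      intro z
      by_cases hz : z.1 ∈ V
      · exact (dif_pos hz).trans (hfg z.1 hz z.2)
      · exact dif_neg hz
    have hpred : X.isRationalFunction.pred h := by
      refine X.isRationalFunction.locality h fun z => ?_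
      rcases z.2 with hz | hz
      · exact ⟨V, hz, homOfLE le_sup_left,
          (congrArg X.isRationalFunction.pred (funext hhf)).mpr f.2⟩
      · exact ⟨W, hz, homOfLE le_sup_right,
          (congrArg X.isRationalFunction.pred (funext hhg)).mpr g.2⟩
    have hlt : V < V ⊔ W := lt_of_le_of_ne le_sup_left fun e => hx (e ▸ Or.inr hxW)
    obtain ⟨F, hF, hFh⟩ := ih (V ⊔ W) hlt ⟨h, hpred⟩ (by
      rintro ⟨z, hz⟩
      by_cases hzV : z ∈ V
      · exact fun e => hf ⟨z, hzV⟩ ((hhf ⟨z, hzV⟩).symm.trans e)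
      · exact fun e => hg ⟨z, hz.resolve_left hzV⟩ ((hhg ⟨z, hz.resolve_left hzV⟩).symm.trans e))
    exact ⟨F, hF, fun z => (hFh ⟨z.1, Or.inl z.2⟩).trans (hhf z)⟩

lemma isFlasque_rationalUnitsSheaf : TopCat.Sheaf.IsFlasque X.rationalUnitsSheaf := by
  refine isFlasque_of_surjective_top _ fun U s => ?_
  let f : (X.rationalFunctions U)ˣ := Additive.toMul (α := (X.rationalFunctions U)ˣ) s
  obtain ⟨g, hg, hgf⟩ := exists_extension_top U f.1 fun x => (X.unitValue U x f).ne_zero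
  refine ⟨Additive.ofMul (isUnit_rationalFunctions g hg).unit, ?_⟩
  exact congrArg Additive.ofMul (Units.ext (Subtype.ext (funext hgf)))

end AlgebraicGeometry.Scheme

/-! ### Connecting homomorphisms and the class group -/

namespace AlgebraicGeometry.Scheme

open Abelian

section Connecting

variable {X : Scheme.{u}} {S : ShortComplex X.ZarAb}

/-- Exactness of `Γ(X, S₂) → Γ(X, S₃) → H¹(X, S₁)`. -/
lemma connecting₀_eq_zero_iff (hS : S.ShortExact) (s : globalSections S.X₃) :
    connecting₀ hS s = 0 ↔ s ∈ (globalSectionsMap S.g).range := by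
  have hT : IsTerminal (⊤ : Opens X) := isTerminalTop
  constructor
  · intro h
    obtain ⟨y, hy⟩ := Ext.covariant_sequence_exact₃ _ hS
      ((Sheaf.H.equiv₀ S.X₃ hT).symm s) (zero_add 1) h
    refine ⟨Sheaf.H.equiv₀ S.X₂ hT y, ?_⟩
    refine (Sheaf.H.equiv₀_naturality hT S.g y).trans ?_
    rw [Sheaf.H.map_apply, hy, AddEquiv.apply_symm_apply]
  · rintro ⟨t, rfl⟩
    have h : (Sheaf.H.equiv₀ S.X₃ hT).symm (globalSectionsMap S.g t) =
        ((Sheaf.H.equiv₀ S.X₂ hT).symm t).comp (Ext.mk₀ S.g) (add_zero 0) :=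
      (Sheaf.H.equiv₀_symm_naturality hT S.g t).symm
    change ((Sheaf.H.equiv₀ S.X₃ hT).symm (globalSectionsMap S.g t)).comp hS.extClass
      (zero_add 1) = 0
    rw [h, Ext.comp_assoc _ _ _ (add_zero 0) (zero_add 1) (by lia), hS.comp_extClass, Ext.comp_zero]

lemma connecting₀_surjective (hS : S.ShortExact) [Subsingleton (Sheaf.H.{u} S.X₂ 1)] :
    Function.Surjective (connecting₀ hS) := by
  intro y
  obtain ⟨x, rfl⟩ := Ext.covariant_sequence_exact₁ _ hS y (Subsingleton.elim _ _) (zero_add 1)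
  refine ⟨Sheaf.H.equiv₀ S.X₃ (T := (⊤ : Opens X)) isTerminalTop x, ?_⟩
  exact congrArg (fun t => Ext.comp t hS.extClass (zero_add 1)) (AddEquiv.symm_apply_apply _ x)

lemma connecting_injective (hS : S.ShortExact) (n : ℕ) [Subsingleton (Sheaf.H.{u} S.X₂ n)] :
    Function.Injective (connecting hS n) := by
  refine (injective_iff_map_eq_zero _).2 fun x hx => ?_
  obtain ⟨y, rfl⟩ := Ext.covariant_sequence_exact₃ _ hS x rfl hx
  rw [Subsingleton.elim y 0, Ext.zero_comp]

lemma connecting_surjective (hS : S.ShortExact) (n : ℕ)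
    [Subsingleton (Sheaf.H.{u} S.X₂ (n + 1))] : Function.Surjective (connecting hS n) := fun y =>
  Ext.covariant_sequence_exact₁ _ hS y (Subsingleton.elim _ _) rfl

end Connecting

section ClassGroup

variable {X : Scheme.{u}} [IsNoetherian X] [X.IsNormal]

lemma classGroupToP_injective : Function.Injective X.classGroupToP := by
  refine (injective_iff_map_eq_zero _).2 fun c hc => ?_
  obtain ⟨D, rfl⟩ := QuotientAddGroup.mk_surjective c
  rw [QuotientAddGroup.eq_zero_iff]
  have hW := shortExact_weilSequence (X := X)
  exact TopCat.Sheaf.sections_exact_of_left_exact hW.exact hW.mono_f D hc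

lemma range_classGroupToP :
    X.classGroupToP.range = (globalSectionsMap (cokernel.π X.cartierToWeil)).range := by
  ext s
  constructor
  · rintro ⟨c, rfl⟩
    obtain ⟨D, rfl⟩ := QuotientAddGroup.mk_surjective c
    exact ⟨D, rfl⟩
  · rintro ⟨D, rfl⟩
    exact ⟨QuotientAddGroup.mk D, rfl⟩

end ClassGroup

end AlgebraicGeometry.Scheme

end

theorem mainTheorem6 (X : AlgebraicGeometry.Scheme.{u})
    [AlgebraicGeometry.IsNoetherian X] [X.IsNormal] :
    ∃ (hC : X.cartierSequence.ShortExact) (hW : X.weilSequence.ShortExact),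
      Function.Injective X.classGroupToP ∧
      ∃ e : (AlgebraicGeometry.Scheme.globalSections X.quotientSheaf ⧸ X.classGroupToP.range) ≃+
          CategoryTheory.Sheaf.H.{u} X.unitsSheaf 2,
        ∀ s : AlgebraicGeometry.Scheme.globalSections X.quotientSheaf,
          e (QuotientAddGroup.mk s) =
            AlgebraicGeometry.Scheme.connecting hC 1
              (AlgebraicGeometry.Scheme.connecting₀ hW s) := by
  have h₁ : Subsingleton (CategoryTheory.Sheaf.H.{u} X.weilSheaf 1) :=
    TopCat.Sheaf.subsingleton_H_of_isFlasque 0 _ AlgebraicGeometry.Scheme.isFlasque_weilSheaf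
  have h₂ (n : ℕ) : Subsingleton (CategoryTheory.Sheaf.H.{u} X.rationalUnitsSheaf (n + 1)) :=
    TopCat.Sheaf.subsingleton_H_of_isFlasque n _
      AlgebraicGeometry.Scheme.isFlasque_rationalUnitsSheaf
  have hC := AlgebraicGeometry.Scheme.shortExact_cartierSequence (X := X)
  have hW := AlgebraicGeometry.Scheme.shortExact_weilSequence (X := X)
  have : Subsingleton (CategoryTheory.Sheaf.H.{u} X.weilSequence.X₂ 1) := h₁
  have : Subsingleton (CategoryTheory.Sheaf.H.{u} X.cartierSequence.X₂ 1) := h₂ 0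
  have : Subsingleton (CategoryTheory.Sheaf.H.{u} X.cartierSequence.X₂ (1 + 1)) := h₂ 1
  refine ⟨hC, hW, AlgebraicGeometry.Scheme.classGroupToP_injective, ?_⟩
  let φ : AlgebraicGeometry.Scheme.globalSections X.quotientSheaf →+
      CategoryTheory.Sheaf.H.{u} X.unitsSheaf 2 :=
    (AlgebraicGeometry.Scheme.connecting hC 1).comp (AlgebraicGeometry.Scheme.connecting₀ hW)
  have hφ : Function.Surjective φ :=
    (AlgebraicGeometry.Scheme.connecting_surjective hC 1).comp
      (AlgebraicGeometry.Scheme.connecting₀_surjective hW)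
  have hker : X.classGroupToP.range = φ.ker := by
    rw [AlgebraicGeometry.Scheme.range_classGroupToP]
    ext s
    refine (AlgebraicGeometry.Scheme.connecting₀_eq_zero_iff hW s).symm.trans ?_
    exact (map_eq_zero_iff _ (AlgebraicGeometry.Scheme.connecting_injective hC 1)).symm
  exact ⟨(QuotientAddGroup.quotientAddEquivOfEq hker).trans
    (QuotientAddGroup.quotientKerEquivOfSurjective φ hφ), fun s => rfl⟩
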